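/- Let $m(\xi)=\sqrt{\tanh(\xi)/\xi}$ for $\xi\neq 0$, $m(0)=1$, and let $K=\mathcal F^{-1}m$ be the Whitham kernel, that is, for $x\neq 0$, $$K(x)=\frac1{2\pi}\int_{\mathbb R} m(\xi)\,e^{ix\xi}\,d\xi=\lim_{N\to\infty}\frac1{2\pi}\int_{-N}^{N} m(\xi)\,e^{ix\xi}\,d\xi .$$ For $c\in\mathbb R$, a function $\varphi:\mathbb R\to\mathbb R$ is called a solution with wave speed $c$ if $$c\,\varphi(x)-(K*\varphi)(x)-\varphi(x)^2=0\qquad\text{for every }x\in\mathbb R,$$ where $(K*\varphi)(x)=\int_{\mathbb R}K(y)\varphi(x-y)\,dy$. Let $\varphi$ be a bounded solution with wave speed $c$ such that the limits $\lim_{x\to+\infty}\varphi(x)$ and $\lim_{x\to-\infty}\varphi(x)$ exist (and are finite, but not necessarily equal). 1. If $\varphi$ is continuously differentiable, then $$\lim_{R\to\infty}\int_{-R}^{R}\varphi(x)\bigl(\varphi(x)-(c-1)\bigr)\,dx=0 .$$ 2. If $\varphi$ is continuous (in particular, if it is continuously differentiable) and $c\geq 1$, then $\inf_{\mathbb R}\varphi<c-1<\sup_{\mathbb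 R}\varphi$, or $\varphi\equiv 0$, or $\varphi\equiv c-1$. -/

import Mathlib

open MeasureTheory Filter Topology

namespace Whitham

/-- The Whitham symbol `m(ξ) = √(tanh ξ / ξ)`, with its continuous value `m(0) = 1`. -/
noncomputable def symbol (ξ : ℝ) : ℝ :=
  if ξ = 0 then 1 else Real.sqrt (Real.tanh ξ / ξ)

/-- The Whitham kernel `K(x) = (1 / 2π) ∫_ℝ m(ξ) exp(i x ξ) dξ`, the inverse Fourier transform of
the Whitham symbol. As `m` is not Lebesgue integrable (it decays like `|ξ|^(-1/2)`), the integral is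
the improper one, `lim_{N → ∞} ∫_{-N}^{N}`, which converges for every `x ≠ 0`; at `x = 0`, where
`K` is singular, the value is a junk value on a null set. The integrals are real because `m` is
even, so taking the real part only changes the type. -/
noncomputable def kernel (x : ℝ) : ℝ :=
  (limUnder atTop fun N : ℝ =>
    (1 / (2 * (Real.pi : ℂ))) *
      ∫ ξ in (-N)..N, (symbol ξ : ℂ) * Complex.exp (Complex.I * (x : ℂ) * (ξ : ℂ))).re

/-- `φ` solves `c φ - K * φ - φ² = 0` pointwise on `ℝ`, where `K * φ` is the convolution
`x ↦ ∫ K(y) φ(x - y) dy`. -/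
def IsSolution (c : ℝ) (φ : ℝ → ℝ) : Prop :=
  ∀ x : ℝ,
    c * φ x - convolution kernel φ (ContinuousLinearMap.mul ℝ ℝ) volume x - φ x ^ 2 = 0

end Whitham

namespace Whitham

/-! ### The product expansion of the symbol -/

/-! Three facts about the kernel carry the proof: `K ≥ 0` almost everywhere, `∫ K = 1`, and `x K(x)`
is integrable with integral zero. They make the equation read `φ (φ - (c - 1)) = ∫ K(y) (φ(x) - φ(x
- y)) dy`. Integrated over `[-R, R]`, the right side becomes a difference of window integrals at the
two ends, which tends to `(b - a) ∫ y K(y) dy = 0`, with `a`, `b` the limits of `φ` at `-∞`, `+∞`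
(`IsSolution.tendsto_integral`). For `c ≥ 1`, averaging against `K` gives `inf φ ≥ 0` (via
`IsSolution.le_iInf`). If `c - 1` is not strictly between the infimum and the supremum, then `φ (φ -
(c - 1))` has one sign and integral zero, so it vanishes and `φ` is constant.

The facts about `K` come from writing the symbol as `∫ (t + ξ²)⁻¹ dμ(t)` with `μ ≥ 0` supported away
from `0`. Its square is an infinite product of quotients with interlacing zeros and poles; each
square-root factor is a Stieltjes transform plus a constant, and multiplying by the next factor only
adds mass to the measure. Fourier inversion under the integral then exhibits `K` as a mixture of
Laplace densities (`SymbolMeasure.kernel_eq`). -/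

/-- The squared poles of `tanh` on the imaginary axis. -/
noncomputable def poleSq (n : ℕ) : ℝ := (Real.pi * (n + 1 / 2)) ^ 2

/-- The squared nonzero zeros of `tanh` on the imaginary axis. -/
noncomputable def zeroSq (n : ℕ) : ℝ := (Real.pi * (n + 1)) ^ 2

lemma poleSq_pos (n : ℕ) : 0 < poleSq n := by
  have := Real.pi_pos
  unfold poleSq; positivity

lemma poleSq_lt_zeroSq (n : ℕ) : poleSq n < zeroSq n := by
  have := Real.pi_pos
  unfold poleSq zeroSq; gcongr; norm_num

lemma zeroSq_pos (n : ℕ) : 0 < zeroSq n := (poleSq_pos n).trans (poleSq_lt_zeroSq n)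

lemma zeroSq_lt_poleSq_succ (n : ℕ) : zeroSq n < poleSq (n + 1) := by
  have := Real.pi_pos
  unfold poleSq zeroSq
  refine pow_lt_pow_left₀ (mul_lt_mul_of_pos_left ?_ this) (by positivity) two_ne_zero
  push_cast; linarith

/-- Euler's sine product at `i x / π`. -/
lemma tendsto_euler_sinh_prod (x : ℝ) :
    Tendsto (fun n : ℕ => x * ∏ j ∈ Finset.range n, (1 + x ^ 2 / zeroSq j)) atTop
      (𝓝 (Real.sinh x)) := by
  have hpi : (Real.pi : ℂ) ≠ 0 := by exact_mod_cast Real.pi_ne_zero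
  have h := (Complex.tendsto_euler_sin_prod (x * Complex.I / Real.pi)).mul_const (-Complex.I)
  have h2 := (Complex.continuous_re.tendsto _).comp h
  have e : (Real.pi : ℂ) * (x * Complex.I / Real.pi) = x * Complex.I := by field_simp
  rw [e, Complex.sin_mul_I] at h2
  refine Tendsto.congr (fun n => ?_) (h2.trans_eq ?_)
  · have : ∏ j ∈ Finset.range n, ((1 : ℂ) - (x * Complex.I / Real.pi) ^ 2 / ((j : ℂ) + 1) ^ 2)
        = ((∏ j ∈ Finset.range n, (1 + x ^ 2 / zeroSq j) : ℝ) : ℂ) := by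
      push_cast
      refine Finset.prod_congr rfl fun j _ => ?_
      unfold zeroSq
      push_cast
      rw [div_pow, mul_pow, Complex.I_sq, div_div, ← mul_pow]
      ring
    simp only [Function.comp_apply]
    rw [this]
    rw [show (x : ℂ) * Complex.I *
      ((∏ j ∈ Finset.range n, (1 + x ^ 2 / zeroSq j) : ℝ) : ℂ) * (-Complex.I) =
      ((x * ∏ j ∈ Finset.range n, (1 + x ^ 2 / zeroSq j) : ℝ) : ℂ) from by
        push_cast
        linear_combination (-(x : ℂ) * ∏ j ∈ Finset.range n, (1 + (x : ℂ) ^ 2 / zeroSq j)) *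
          Complex.I_sq]
    exact Complex.ofReal_re _
  · rw [show Complex.sinh x * Complex.I * -Complex.I = Complex.sinh x from by
      linear_combination (-Complex.sinh x) * Complex.I_sq]
    rw [← Complex.ofReal_sinh, Complex.ofReal_re]

/-- `zeroSq (2 n) = 4 poleSq n` and `zeroSq (2 n + 1) = 4 zeroSq n`: the zeros of `sinh (2 x)` split
into those of `cosh` and `sinh`. -/
lemma prod_zeroSq_two_mul (x : ℝ) (n : ℕ) :
    ∏ j ∈ Finset.range (2 * n), (1 + (2 * x) ^ 2 / zeroSq j) =
      (∏ j ∈ Finset.range n, (1 + x ^ 2 / poleSq j)) *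
        ∏ j ∈ Finset.range n, (1 + x ^ 2 / zeroSq j) := by
  induction n with
  | zero => simp
  | succ n ih =>
    rw [show 2 * (n + 1) = 2 * n + 1 + 1 by ring, Finset.prod_range_succ, Finset.prod_range_succ,
      ih, Finset.prod_range_succ _ n, Finset.prod_range_succ _ n]
    have hpi := Real.pi_pos
    have e1 : (2 * x) ^ 2 / zeroSq (2 * n) = x ^ 2 / poleSq n := by
      unfold zeroSq poleSq; push_cast
      rw [div_eq_div_iff (by positivity) (by positivity)]; ring
    have e2 : (2 * x) ^ 2 / zeroSq (2 * n + 1) = x ^ 2 / zeroSq n := by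
      unfold zeroSq; push_cast
      rw [div_eq_div_iff (by positivity) (by positivity)]; ring
    rw [e1, e2]; ring

lemma tendsto_prod_tanh {x : ℝ} (hx : x ≠ 0) :
    Tendsto (fun n : ℕ => ∏ j ∈ Finset.range n, ((1 + x ^ 2 / zeroSq j) / (1 + x ^ 2 / poleSq j)))
      atTop (𝓝 (Real.tanh x / x)) := by
  have h1 := tendsto_euler_sinh_prod x
  have h2 := (tendsto_euler_sinh_prod (2 * x)).comp
    (tendsto_id.const_mul_atTop' (show 0 < 2 by norm_num))
  have hs : Real.sinh (2 * x) ≠ 0 := by simpa using hx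
  -- `tanh x = 2 sinh² x / sinh (2 x)`, so no separate product for `cosh` is needed.
  have h3 := ((h1.pow 2).const_mul 2).div (h2.const_mul x) (mul_ne_zero hx hs)
  refine Tendsto.congr (fun n => ?_) (h3.trans_eq ?_)
  · have p1 : ∏ j ∈ Finset.range n, (1 + x ^ 2 / poleSq j) ≠ 0 :=
      Finset.prod_ne_zero_iff.2 fun j _ => by have := poleSq_pos j; positivity
    have p2 : ∏ j ∈ Finset.range n, (1 + x ^ 2 / zeroSq j) ≠ 0 :=
      Finset.prod_ne_zero_iff.2 fun j _ => by have := zeroSq_pos j; positivity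
    simp only [Function.comp_apply, id, Pi.div_apply]
    rw [prod_zeroSq_two_mul, Finset.prod_div_distrib]
    field_simp
  · have hc := (Real.cosh_pos x).ne'
    have hs' : Real.sinh x ≠ 0 := by simpa using hx
    rw [Real.sinh_two_mul, Real.tanh_eq_sinh_div_cosh]
    congr 1
    field_simp

/-- The elementary factor `√((1 + l / b) / (1 + l / a))`. -/
noncomputable def factor (a b l : ℝ) : ℝ := Real.sqrt ((1 + l / b) / (1 + l / a))

lemma tendsto_prod_factor (x : ℝ) :
    Tendsto (fun n : ℕ => ∏ j ∈ Finset.range n, factor (poleSq j) (zeroSq j) (x ^ 2)) atTop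
      (𝓝 (symbol x)) := by
  by_cases hx : x = 0
  · simp [factor, symbol, hx]
  · have h := (Real.continuous_sqrt.tendsto _).comp (tendsto_prod_tanh hx)
    simp only [symbol, hx, if_false]
    refine h.congr fun n => ?_
    simp only [Function.comp_apply, factor]
    rw [Real.sqrt_prod]
    intro j _
    have := poleSq_pos j
    have := zeroSq_pos j
    positivity

lemma tendsto_symbol_atTop : Tendsto symbol atTop (𝓝 0) := by
  have h : Tendsto (fun x : ℝ => Real.sqrt x⁻¹) atTop (𝓝 0) := by
    exact Real.sqrt_zero ▸ (Real.continuous_sqrt.tendsto 0).comp tendsto_inv_atTop_zero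
  refine tendsto_of_tendsto_of_tendsto_of_le_of_le' tendsto_const_nhds h ?_ ?_
  · filter_upwards [eventually_gt_atTop 0] with x hx
    simp only [symbol, hx.ne', if_false]; positivity
  · filter_upwards [eventually_gt_atTop 0] with x hx
    simp only [symbol, hx.ne', if_false]
    apply Real.sqrt_le_sqrt
    rw [div_eq_mul_inv]
    exact mul_le_of_le_one_left (by positivity) (Real.tanh_lt_one x).le

/-! ### Stieltjes representation of the symbol -/

lemma integrable_inv_add_sq {p : ℝ} (hp : 0 < p) : Integrable fun u : ℝ => (p + u ^ 2)⁻¹ := by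
  have h := (integrable_inv_one_add_sq.comp_div (Real.sqrt_ne_zero'.2 hp)).const_mul p⁻¹
  refine h.congr (.of_forall fun u => ?_)
  simp only [div_pow, Real.sq_sqrt hp.le]
  field_simp

lemma integral_inv_add_sq {p : ℝ} (hp : 0 < p) :
    ∫ u : ℝ, (p + u ^ 2)⁻¹ = Real.pi / Real.sqrt p := by
  have h := Measure.integral_comp_div (fun u : ℝ => (1 + u ^ 2)⁻¹) (Real.sqrt p)
  have e : ∀ u : ℝ, (p + u ^ 2)⁻¹ = p⁻¹ * (1 + (u / Real.sqrt p) ^ 2)⁻¹ := fun u => by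
    simp only [div_pow, Real.sq_sqrt hp.le]
    field_simp
  simp_rw [e]
  rw [integral_const_mul, h, integral_univ_inv_one_add_sq, abs_of_nonneg (Real.sqrt_nonneg p),
    smul_eq_mul]
  have := Real.sqrt_pos.2 hp
  nth_rewrite 1 [← Real.mul_self_sqrt hp.le]
  field_simp

lemma integral_partial_fractions {p : ℝ} (hp : 0 < p) :
    ∫ u : ℝ, (p - 1) * (u ^ 2 * ((1 + u ^ 2)⁻¹ * (p + u ^ 2)⁻¹)) =
      Real.pi * (Real.sqrt p - 1) := by
  have e : ∀ u : ℝ, (p - 1) * (u ^ 2 * ((1 + u ^ 2)⁻¹ * (p + u ^ 2)⁻¹)) =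
      p * (p + u ^ 2)⁻¹ - (1 + u ^ 2)⁻¹ := fun u => by
    field_simp; ring
  simp_rw [e]
  rw [integral_sub ((integrable_inv_add_sq hp).const_mul p) integrable_inv_one_add_sq,
    integral_const_mul, integral_inv_add_sq hp, integral_univ_inv_one_add_sq]
  have := Real.sqrt_pos.2 hp
  nth_rewrite 1 [← Real.mul_self_sqrt hp.le]
  field_simp

/-- `G` is, off the interval `[-b, -a]`, a constant plus the Stieltjes transform of a finite
measure on `[a, b]`. -/
structure StieltjesRep (a b A : ℝ) (μ : Measure ℝ) (G : ℝ → ℝ) : Prop where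
  finite : IsFiniteMeasure μ
  mem : ∀ᵐ t ∂μ, a ≤ t ∧ t ≤ b
  eq : ∀ l, -a < l ∨ l < -b → G l = A + ∫ t, (t + l)⁻¹ ∂μ

/-- The jump of the factor across its cut has density proportional to `√((b - t) / (t - a))`.
Substituting `u² = (b - t) / (t - a)`, that is `t = T u`, makes the integrand rational on the whole
line. -/
lemma exists_stieltjesRep_factor {a b : ℝ} (ha : 0 < a) (hab : a < b) :
    ∃ ρ, StieltjesRep a b (Real.sqrt (a / b)) ρ (factor a b) := by
  have hb := ha.trans hab
  have hpi := Real.pi_pos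
  set k := Real.sqrt (a / b) with hk
  have hk0 : 0 ≤ k := Real.sqrt_nonneg _
  set w : ℝ → ℝ := fun u => k * ((b - a) / Real.pi) * (u ^ 2 * ((1 + u ^ 2)⁻¹ * (1 + u ^ 2)⁻¹)) with hw
  set T : ℝ → ℝ := fun u => (b + a * u ^ 2) / (1 + u ^ 2) with hT
  have hTm : Measurable T := by fun_prop
  have hwm : Measurable w := by fun_prop
  have hw0 : ∀ u, 0 ≤ w u := fun u => by
    have : 0 < b - a := sub_pos.2 hab
    simp only [hw]; positivity
  have hwi : Integrable w := by
    refine (integrable_inv_one_add_sq.const_mul (k * ((b - a) / Real.pi))).mono'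
      hwm.aestronglyMeasurable (.of_forall fun u => ?_)
    rw [Real.norm_of_nonneg (hw0 u)]
    have : 0 < b - a := sub_pos.2 hab
    simp only [hw]
    gcongr
    rw [← mul_assoc, ← div_eq_mul_inv]
    exact mul_le_of_le_one_left (by positivity) ((div_le_one (by positivity)).2 (by linarith))
  set ρ := (volume.withDensity fun u => ENNReal.ofReal (w u)).map T with hρ
  refine ⟨ρ, ?_, ?_, ?_⟩
  · have := isFiniteMeasure_withDensity_ofReal hwi.2
    exact Measure.isFiniteMeasure_map _ _
  · rw [hρ, ae_map_iff hTm.aemeasurable (measurableSet_Icc (a := a) (b := b))]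
    refine .of_forall fun u => ?_
    simp only [hT]
    constructor
    · rw [le_div_iff₀ (by positivity)]; nlinarith
    · rw [div_le_iff₀ (by positivity)]; nlinarith [sq_nonneg u]
  · intro l hl
    have hal : a + l ≠ 0 := by rcases hl with h | h <;> intro h' <;> linarith
    -- `p` is positive on either side of the cut, so one computation covers both.
    set p := (b + l) / (a + l) with hp
    have hp0 : 0 < p := by
      rcases hl with h | h
      · exact div_pos (by linarith) (by linarith)
      · exact div_pos_of_neg_of_neg (by linarith) (by linarith)
    rw [hρ, integral_map hTm.aemeasurable (by fun_prop)]
    rw [integral_withDensity_eq_integral_toReal_smul (by fun_prop) (by simp)]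
    have e : ∀ u, (ENNReal.ofReal (w u)).toReal • (T u + l)⁻¹ =
        (k / Real.pi) * ((p - 1) * (u ^ 2 * ((1 + u ^ 2)⁻¹ * (p + u ^ 2)⁻¹))) := fun u => by
      have h1 : 0 < 1 + u ^ 2 := by positivity
      have h2 : 0 < p + u ^ 2 := by positivity
      have h3 : T u + l = (a + l) * (p + u ^ 2) / (1 + u ^ 2) := by
        simp only [hT, hp]; field_simp; ring
      have h4 : p - 1 = (b - a) / (a + l) := by simp only [hp]; field_simp; ring
      rw [ENNReal.toReal_ofReal (hw0 u), h3, h4]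
      simp only [hw, smul_eq_mul]
      field_simp
    simp_rw [e]
    rw [integral_const_mul, integral_partial_fractions hp0]
    have : factor a b l = k * Real.sqrt p := by
      rw [hk, ← Real.sqrt_mul (by positivity), factor]
      congr 1
      simp only [hp]
      have : 1 + l / a ≠ 0 := by
        intro h; apply hal; field_simp at h; linarith
      field_simp
    rw [this]
    field_simp
    ring

lemma exists_abs_inv_add_le {a b l : ℝ} (hl : -a < l ∨ l < -b) :
    ∃ C : ℝ, ∀ t, a ≤ t ∧ t ≤ b → |(t + l)⁻¹| ≤ C := by
  rcases hl with h | h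
  · refine ⟨(a + l)⁻¹, fun t ht => ?_⟩
    rw [abs_of_nonneg (inv_nonneg.2 (by linarith))]
    exact inv_anti₀ (by linarith) (by linarith)
  · refine ⟨(-(b + l))⁻¹, fun t ht => ?_⟩
    rw [abs_inv, abs_of_neg (by linarith)]
    exact inv_anti₀ (by linarith) (by linarith)

namespace StieltjesRep

variable {a b a' b' A B : ℝ} {μ ρ : Measure ℝ} {G H : ℝ → ℝ}

lemma integrable (h : StieltjesRep a b A μ G) {l : ℝ} (hl : -a < l ∨ l < -b) :
    Integrable (fun t => (t + l)⁻¹) μ := by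
  have := h.finite
  obtain ⟨C, hC⟩ := exists_abs_inv_add_le hl
  exact Integrable.of_bound (by fun_prop) C (h.mem.mono fun t ht => hC t ht)

/-- Partial fractions: `(s + l)⁻¹ (t + l)⁻¹ = (t - s)⁻¹ ((s + l)⁻¹ - (t + l)⁻¹)`. The gap `b < a'`
keeps `(t - s)⁻¹` bounded. Evaluating `G` at `-t` is where the branch `l < -b` of the representation
is needed. -/
lemma mul_apply (h : StieltjesRep a b A μ G) (h' : StieltjesRep a' b' B ρ H)
    (hba : b < a') (haa : a ≤ a') (hbb : b ≤ b')
    {l : ℝ} (hl : -a < l ∨ l < -b') :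
    G l * H l = A * B + (∫ s, H (-s) * (s + l)⁻¹ ∂μ) + ∫ t, G (-t) * (t + l)⁻¹ ∂ρ := by
  have := h.finite
  have := h'.finite
  have hl1 : -a < l ∨ l < -b := hl.imp_right fun h => by linarith
  have hl2 : -a' < l ∨ l < -b' := hl.imp_left fun h => by linarith
  obtain ⟨C, hC⟩ := exists_abs_inv_add_le hl1
  obtain ⟨D, hD⟩ := exists_abs_inv_add_le hl2
  have m1 : ∀ᵐ z ∂(μ.prod ρ), a ≤ z.1 ∧ z.1 ≤ b := Measure.quasiMeasurePreserving_fst.ae h.mem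
  have m2 : ∀ᵐ z ∂(μ.prod ρ), a' ≤ z.2 ∧ z.2 ≤ b' := Measure.quasiMeasurePreserving_snd.ae h'.mem
  have bd : ∀ s t : ℝ, s ≤ b → a' ≤ t → |(t - s)⁻¹| ≤ (a' - b)⁻¹ := fun s t hs ht => by
    rw [abs_of_nonneg (inv_nonneg.2 (by linarith))]
    exact inv_anti₀ (by linarith) (by linarith)
  have i1 : Integrable (fun z : ℝ × ℝ => (z.1 + l)⁻¹ * (z.2 - z.1)⁻¹) (μ.prod ρ) := by
    refine Integrable.of_bound (by fun_prop) (C * (a' - b)⁻¹) ?_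
    filter_upwards [m1, m2] with z h1 h2
    rw [norm_mul]
    exact mul_le_mul (hC _ h1) (bd _ _ h1.2 h2.1) (norm_nonneg _) ((abs_nonneg _).trans (hC _ h1))
  have i2 : Integrable (fun z : ℝ × ℝ => (z.2 + l)⁻¹ * (z.1 - z.2)⁻¹) (μ.prod ρ) := by
    refine Integrable.of_bound (by fun_prop) (D * (a' - b)⁻¹) ?_
    filter_upwards [m1, m2] with z h1 h2
    rw [norm_mul]
    refine mul_le_mul (hD _ h2) ?_ (norm_nonneg _) ((abs_nonneg _).trans (hD _ h2))
    rw [← neg_sub, inv_neg, norm_neg]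
    exact bd _ _ h1.2 h2.1
  have j1 := h.integrable hl1
  have j2 := h'.integrable hl2
  have e1 : ∫ s, H (-s) * (s + l)⁻¹ ∂μ =
      B * (∫ s, (s + l)⁻¹ ∂μ) + ∫ z, (z.1 + l)⁻¹ * (z.2 - z.1)⁻¹ ∂(μ.prod ρ) := by
    rw [integral_prod _ i1, ← integral_const_mul, ← integral_add (j1.const_mul B) i1.integral_prod_left]
    refine integral_congr_ae (h.mem.mono fun s hs => ?_)
    simp only
    rw [h'.eq (-s) (.inl (by linarith)), integral_const_mul]
    simp only [← sub_eq_add_neg]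
    ring
  have e2 : ∫ t, G (-t) * (t + l)⁻¹ ∂ρ =
      A * (∫ t, (t + l)⁻¹ ∂ρ) + ∫ z, (z.2 + l)⁻¹ * (z.1 - z.2)⁻¹ ∂(μ.prod ρ) := by
    rw [integral_prod_symm _ i2, ← integral_const_mul,
      ← integral_add (j2.const_mul A) i2.integral_prod_right]
    refine integral_congr_ae (h'.mem.mono fun t ht => ?_)
    simp only
    rw [h.eq (-t) (.inr (by linarith)), integral_const_mul]
    simp only [← sub_eq_add_neg]
    ring
  have e3 : (∫ z, (z.1 + l)⁻¹ * (z.2 - z.1)⁻¹ ∂(μ.prod ρ)) +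
      ∫ z, (z.2 + l)⁻¹ * (z.1 - z.2)⁻¹ ∂(μ.prod ρ) =
      (∫ s, (s + l)⁻¹ ∂μ) * ∫ t, (t + l)⁻¹ ∂ρ := by
    rw [← integral_prod_mul, ← integral_add i1 i2]
    refine integral_congr_ae ?_
    filter_upwards [m1, m2] with z h1 h2
    have n1 : z.1 + l ≠ 0 := by rcases hl1 with h | h <;> intro _ <;> linarith
    have n2 : z.2 + l ≠ 0 := by rcases hl2 with h | h <;> intro _ <;> linarith
    have n3 : z.2 - z.1 ≠ 0 := by intro _; linarith
    rw [← neg_sub z.2 z.1, inv_neg]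
    field_simp
    ring
  rw [h.eq l hl1, h'.eq l hl2, e1, e2]
  linear_combination -e3

lemma exists_abs_neg_le (h : StieltjesRep a b A μ G) {c d : ℝ} (hd : d < a ∨ b < c) :
    ∃ C : ℝ, ∀ t, c ≤ t ∧ t ≤ d → |G (-t)| ≤ C := by
  have := h.finite
  refine ⟨|A| + |a - d|⁻¹ * μ.real Set.univ + |c - b|⁻¹ * μ.real Set.univ, fun t ht => ?_⟩
  have p1 : 0 ≤ |a - d|⁻¹ * μ.real Set.univ := by positivity
  have p2 : 0 ≤ |c - b|⁻¹ * μ.real Set.univ := by positivity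
  rw [h.eq (-t) (hd.imp (fun _ => by linarith) fun _ => by linarith)]
  refine (abs_add_le _ _).trans ?_
  rcases hd with hd | hd
  · have : |∫ s, (s + -t)⁻¹ ∂μ| ≤ |a - d|⁻¹ * μ.real Set.univ := by
      rw [← Real.norm_eq_abs]
      refine norm_integral_le_of_norm_le_const (h.mem.mono fun s hs => ?_)
      rw [norm_inv, Real.norm_eq_abs, abs_of_pos (by linarith), abs_of_pos (by linarith)]
      exact inv_anti₀ (by linarith) (by linarith)
    linarith
  · have : |∫ s, (s + -t)⁻¹ ∂μ| ≤ |c - b|⁻¹ * μ.real Set.univ := by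
      rw [← Real.norm_eq_abs]
      refine norm_integral_le_of_norm_le_const (h.mem.mono fun s hs => ?_)
      rw [norm_inv, Real.norm_eq_abs, abs_of_neg (by linarith), abs_of_pos (by linarith)]
      exact inv_anti₀ (by linarith) (by linarith)
    linarith

/-- The product of two functions with Stieltjes representations on successive intervals has a
Stieltjes representation, whose measure dominates the first one. -/
lemma exists_mul (h : StieltjesRep a b A μ G) (h' : StieltjesRep a' b' B ρ H)
    (hba : b < a') (haa : a ≤ a') (hbb : b ≤ b') (hGm : Measurable G) (hHm : Measurable H)
    (hG : ∀ t, a' ≤ t ∧ t ≤ b' → 0 ≤ G (-t)) (hH : ∀ s, a ≤ s ∧ s ≤ b → 1 ≤ H (-s)) :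
    ∃ δ, IsFiniteMeasure δ ∧ StieltjesRep a b' (A * B) (μ + δ) fun l => G l * H l := by
  have := h.finite
  have := h'.finite
  obtain ⟨C, hC⟩ := h.exists_abs_neg_le (c := a') (d := b') (.inr hba)
  obtain ⟨D, hD⟩ := h'.exists_abs_neg_le (c := a) (d := b) (.inl hba)
  have iG : Integrable (fun t => G (-t)) ρ :=
    Integrable.of_bound (hGm.comp measurable_neg).aestronglyMeasurable C
      (h'.mem.mono fun t ht => hC t ht)
  have iH : Integrable (fun t => H (-t) - 1) μ :=
    (Integrable.of_bound (hHm.comp measurable_neg).aestronglyMeasurable D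
      (h.mem.mono fun t ht => hD t ht)).sub (integrable_const 1)
  have f1 := isFiniteMeasure_withDensity_ofReal iG.2
  have f2 := isFiniteMeasure_withDensity_ofReal iH.2
  have mG : Measurable fun t => ENNReal.ofReal (G (-t)) := (hGm.comp measurable_neg).ennreal_ofReal
  have mH : Measurable fun t => ENNReal.ofReal (H (-t) - 1) :=
    ((hHm.comp measurable_neg).sub_const 1).ennreal_ofReal
  -- By `mul_apply` the product has measure `H(-s) μ + G(-t) ρ`; splitting `H = 1 + (H - 1)`
  -- isolates `μ`, and `hH`, `hG` make the remainder nonnegative.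
  refine ⟨μ.withDensity (fun s => ENNReal.ofReal (H (-s) - 1)) +
    ρ.withDensity (fun t => ENNReal.ofReal (G (-t))), inferInstance, inferInstance, ?_, ?_⟩
  · have q1 : ∀ᵐ t ∂μ, a ≤ t ∧ t ≤ b' := h.mem.mono fun t ht => ⟨ht.1, ht.2.trans hbb⟩
    have q2 : ∀ᵐ t ∂ρ, a ≤ t ∧ t ≤ b' := h'.mem.mono fun t ht => ⟨haa.trans ht.1, ht.2⟩
    simp only [ae_add_measure_iff]
    exact ⟨q1, (withDensity_absolutelyContinuous _ _).ae_le q1,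
      (withDensity_absolutelyContinuous _ _).ae_le q2⟩
  · intro l hl
    have hl1 : -a < l ∨ l < -b := hl.imp_right fun h => by linarith
    have hl2 : -a' < l ∨ l < -b' := hl.imp_left fun h => by linarith
    obtain ⟨E, hE⟩ := exists_abs_inv_add_le hl1
    obtain ⟨F, hF⟩ := exists_abs_inv_add_le hl2
    have k1 : Integrable (fun t => (t + l)⁻¹) (μ.withDensity fun s => ENNReal.ofReal (H (-s) - 1)) :=
      Integrable.of_bound (by fun_prop) E
        ((withDensity_absolutelyContinuous _ _).ae_le (h.mem.mono fun t ht => hE t ht))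
    have k2 : Integrable (fun t => (t + l)⁻¹) (ρ.withDensity fun s => ENNReal.ofReal (G (-s))) :=
      Integrable.of_bound (by fun_prop) F
        ((withDensity_absolutelyContinuous _ _).ae_le (h'.mem.mono fun t ht => hF t ht))
    have k0 := h.integrable hl1
    have e1 : ∫ t, (t + l)⁻¹ ∂(μ.withDensity fun s => ENNReal.ofReal (H (-s) - 1)) =
        (∫ s, H (-s) * (s + l)⁻¹ ∂μ) - ∫ s, (s + l)⁻¹ ∂μ := by
      have hi : Integrable (fun s => H (-s) * (s + l)⁻¹) μ := by
        refine Integrable.of_bound ((hHm.comp measurable_neg).aestronglyMeasurable.mul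
          (by fun_prop)) (D * E) (h.mem.mono fun t ht => ?_)
        rw [norm_mul]
        exact mul_le_mul (hD t ht) (hE t ht) (norm_nonneg _) ((abs_nonneg _).trans (hD t ht))
      rw [integral_withDensity_eq_integral_toReal_smul mH (by simp), ← integral_sub hi k0]
      refine integral_congr_ae (h.mem.mono fun s hs => ?_)
      simp only [smul_eq_mul]
      rw [ENNReal.toReal_ofReal (by linarith [hH s hs])]
      ring
    have e2 : ∫ t, (t + l)⁻¹ ∂(ρ.withDensity fun s => ENNReal.ofReal (G (-s))) =
        ∫ s, G (-s) * (s + l)⁻¹ ∂ρ := by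
      rw [integral_withDensity_eq_integral_toReal_smul mG (by simp)]
      refine integral_congr_ae (h'.mem.mono fun s hs => ?_)
      simp only [smul_eq_mul]
      rw [ENNReal.toReal_ofReal (hG s hs)]
    rw [h.mul_apply h' hba haa hbb hl, integral_add_measure k0 (k1.add_measure k2),
      integral_add_measure k1 k2, e1, e2]
    ring

end StieltjesRep

/-! ### Passage to the infinite product -/

/-- The partial products of the symbol, as a function of the squared frequency. -/
noncomputable def partialProd (n : ℕ) (l : ℝ) : ℝ :=
  ∏ j ∈ Finset.range (n + 1), factor (poleSq j) (zeroSq j) l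

lemma measurable_factor (a b : ℝ) : Measurable (factor a b) := by
  unfold factor; fun_prop

lemma measurable_partialProd (n : ℕ) : Measurable (partialProd n) :=
  Finset.measurable_prod _ fun _ _ => measurable_factor _ _

lemma partialProd_nonneg (n : ℕ) (l : ℝ) : 0 ≤ partialProd n l :=
  Finset.prod_nonneg fun _ _ => Real.sqrt_nonneg _

/-- Left of its first singularity the factor exceeds one because its pole precedes its zero; this
makes the measures of the partial products increase. -/
lemma one_le_factor_neg {a b s : ℝ} (ha : 0 < a) (hab : a ≤ b) (hs : 0 ≤ s) (hsa : s < a) :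
    1 ≤ factor a b (-s) := by
  unfold factor
  rw [Real.one_le_sqrt]
  have : s / a < 1 := (div_lt_one ha).2 hsa
  rw [one_le_div (by rw [neg_div]; linarith), neg_div, neg_div]
  have : s / b ≤ s / a := by gcongr
  linarith

/-- The constant term of the Stieltjes representation of `partialProd n`. -/
noncomputable def constTerm (n : ℕ) : ℝ :=
  ∏ j ∈ Finset.range (n + 1), Real.sqrt (poleSq j / zeroSq j)

lemma poleSq_strictMono : StrictMono poleSq :=
  strictMono_nat_of_lt_succ fun n => (poleSq_lt_zeroSq n).trans (zeroSq_lt_poleSq_succ n)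

lemma exists_measure_add (n : ℕ) {μ : Measure ℝ}
    (h : StieltjesRep (poleSq 0) (zeroSq n) (constTerm n) μ (partialProd n)) :
    ∃ δ, IsFiniteMeasure δ ∧ StieltjesRep (poleSq 0) (zeroSq (n + 1)) (constTerm (n + 1)) (μ + δ)
      (partialProd (n + 1)) := by
  obtain ⟨ρ, hρ⟩ := exists_stieltjesRep_factor (poleSq_pos (n + 1)) (poleSq_lt_zeroSq (n + 1))
  have := zeroSq_lt_poleSq_succ n
  have := poleSq_lt_zeroSq (n + 1)
  obtain ⟨δ, f, hδ⟩ := h.exists_mul hρ (by linarith) (poleSq_strictMono.monotone (Nat.zero_le _))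
    (by linarith) (measurable_partialProd n) (measurable_factor _ _)
    (fun t _ => partialProd_nonneg _ _)
    (fun s hs => one_le_factor_neg (poleSq_pos _) (by linarith) ((poleSq_pos 0).le.trans hs.1)
      (by linarith [hs.2]))
  refine ⟨δ, f, ?_⟩
  have e1 : constTerm (n + 1) = constTerm n * Real.sqrt (poleSq (n + 1) / zeroSq (n + 1)) :=
    Finset.prod_range_succ _ _
  have e2 : partialProd (n + 1) =
      fun l => partialProd n l * factor (poleSq (n + 1)) (zeroSq (n + 1)) l :=
    funext fun l => Finset.prod_range_succ _ _
  rw [e1, e2]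
  exact hδ

lemma exists_measure_seq : ∃ δ : ℕ → Measure ℝ, (∀ n, IsFiniteMeasure (δ n)) ∧
    ∀ n, StieltjesRep (poleSq 0) (zeroSq n) (constTerm n) (∑ j ∈ Finset.range (n + 1), δ j)
      (partialProd n) := by
  obtain ⟨ρ, hρ⟩ := exists_stieltjesRep_factor (poleSq_pos 0) (poleSq_lt_zeroSq 0)
  have hρ' : StieltjesRep (poleSq 0) (zeroSq 0) (constTerm 0) ρ (partialProd 0) := by
    have e1 : constTerm 0 = Real.sqrt (poleSq 0 / zeroSq 0) := by simp [constTerm]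
    have e2 : partialProd 0 = factor (poleSq 0) (zeroSq 0) := by ext; simp [partialProd]
    rwa [e1, e2]
  choose! d hdf hd using fun n (μ : Measure ℝ) => exists_measure_add n (μ := μ)
  let M : ℕ → Measure ℝ := fun n => Nat.rec ρ (fun n μ => μ + d n μ) n
  have hM : ∀ n, StieltjesRep (poleSq 0) (zeroSq n) (constTerm n) (M n) (partialProd n) := by
    intro n
    induction n with
    | zero => exact hρ'
    | succ n ih => exact hd n _ ih
  -- The increments of `M`, with `ρ` at index `0`; `partialProd n` has `n + 1` factors and so uses
  -- `n + 1` increments.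
  refine ⟨fun n => Nat.casesOn n ρ fun n => d n (M n), ?_, ?_⟩
  · rintro (_ | n)
    · exact hρ.finite
    · exact hdf n _ (hM n)
  · intro n
    convert hM n
    induction n with
    | zero => simp [M]
    | succ n ih => rw [Finset.sum_range_succ, ih]

lemma constTerm_nonneg (n : ℕ) : 0 ≤ constTerm n :=
  Finset.prod_nonneg fun _ _ => Real.sqrt_nonneg _

lemma tendsto_partialProd (x : ℝ) :
    Tendsto (fun n => partialProd n (x ^ 2)) atTop (𝓝 (symbol x)) :=
  (tendsto_add_atTop_iff_nat 1).2 (tendsto_prod_factor x)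

lemma StieltjesRep.le_of_sq {a b A : ℝ} {μ : Measure ℝ} {G : ℝ → ℝ} (h : StieltjesRep a b A μ G)
    (ha : 0 < a) (x : ℝ) : A ≤ G (x ^ 2) := by
  rw [h.eq _ (.inl (by nlinarith))]
  refine le_add_of_nonneg_right (integral_nonneg_of_ae (h.mem.mono fun t ht => ?_))
  have : 0 < t := ha.trans_le ht.1
  simp only [Pi.zero_apply]; positivity

/-- The constant term is at most `partialProd n (x ^ 2)` for every `x`; take `n → ∞` at an `x` where
the symbol is already small. -/
lemma tendsto_constTerm : Tendsto constTerm atTop (𝓝 0) := by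
  obtain ⟨δ, -, hδ⟩ := exists_measure_seq
  rw [Metric.tendsto_atTop]
  intro ε hε
  obtain ⟨x, hx⟩ := (tendsto_symbol_atTop.eventually_lt_const hε).exists
  obtain ⟨N, hN⟩ := eventually_atTop.1 ((tendsto_partialProd x).eventually_lt_const hx)
  refine ⟨N, fun n hn => ?_⟩
  rw [Real.dist_eq, sub_zero, abs_of_nonneg (constTerm_nonneg n)]
  exact ((hδ n).le_of_sq (poleSq_pos 0) x).trans_lt (hN n hn)

/-- The symbol is a Stieltjes transform in the squared frequency. -/
lemma exists_lintegral_eq_symbol : ∃ μ : Measure ℝ, SFinite μ ∧ (∀ᵐ t ∂μ, poleSq 0 ≤ t) ∧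
    ∀ x, ∫⁻ t, ENNReal.ofReal (t + x ^ 2)⁻¹ ∂μ = ENNReal.ofReal (symbol x) := by
  obtain ⟨δ, hf, hδ⟩ := exists_measure_seq
  refine ⟨Measure.sum δ, inferInstance, ?_, fun x => ?_⟩
  · rw [Measure.ae_sum_iff]
    intro n
    refine (Measure.absolutelyContinuous_of_le ?_).ae_le ((hδ n).mem.mono fun t ht => ht.1)
    rw [Finset.sum_range_succ]
    exact Measure.le_add_left le_rfl
  · rw [lintegral_sum_measure]
    refine tendsto_nhds_unique (ENNReal.tendsto_nat_tsum _) ?_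
    rw [← tendsto_add_atTop_iff_nat 1]
    have h1 := ENNReal.tendsto_ofReal ((tendsto_partialProd x).sub tendsto_constTerm)
    rw [sub_zero] at h1
    refine h1.congr fun n => ?_
    have := (hδ n).finite
    have hl : -poleSq 0 < x ^ 2 := by nlinarith [poleSq_pos 0]
    rw [(hδ n).eq _ (.inl hl), add_sub_cancel_left, ← lintegral_finsetSum_measure,
      ofReal_integral_eq_lintegral_ofReal ((hδ n).integrable (.inl hl))]
    refine (hδ n).mem.mono fun t ht => ?_
    have : 0 < t := (poleSq_pos 0).trans_le ht.1
    simp only [Pi.zero_apply]; positivity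

/-- Data of a Stieltjes representation of the symbol. -/
structure SymbolMeasure (μ : Measure ℝ) : Prop where
  sfinite : SFinite μ
  ge : ∀ᵐ t ∂μ, poleSq 0 ≤ t
  integrable : ∀ x : ℝ, Integrable (fun t => (t + x ^ 2)⁻¹) μ
  integral_eq : ∀ x : ℝ, ∫ t, (t + x ^ 2)⁻¹ ∂μ = symbol x

lemma symbol_nonneg (x : ℝ) : 0 ≤ symbol x := by
  unfold symbol; split_ifs <;> positivity

lemma exists_symbolMeasure : ∃ μ, SymbolMeasure μ := by
  obtain ⟨μ, hs, h0, h⟩ := exists_lintegral_eq_symbol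
  have hnn : ∀ x : ℝ, 0 ≤ᵐ[μ] fun t => (t + x ^ 2)⁻¹ := fun x => h0.mono fun t ht => by
    have : 0 < t := (poleSq_pos 0).trans_le ht
    simp only [Pi.zero_apply]; positivity
  refine ⟨μ, hs, h0, fun x => ⟨by fun_prop, ?_⟩, fun x => ?_⟩
  · rw [hasFiniteIntegral_iff_ofReal (hnn x), h]
    exact ENNReal.ofReal_lt_top
  · rw [integral_eq_lintegral_of_nonneg_ae (hnn x) (by fun_prop), h,
      ENNReal.toReal_ofReal (symbol_nonneg x)]

/-! ### Fourier inversion for the Laplace density -/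

lemma integrable_exp_neg_mul_abs {s : ℝ} (hs : 0 < s) :
    Integrable fun x : ℝ => Real.exp (-s * |x|) := by
  rw [← integrableOn_univ, ← Set.Iic_union_Ioi (a := (0 : ℝ)), integrableOn_union]
  constructor
  · refine (integrableOn_exp_mul_Iic hs 0).congr_fun (fun x hx => ?_) measurableSet_Iic
    simp only [abs_of_nonpos (Set.mem_Iic.1 hx)]; ring_nf
  · refine (integrableOn_exp_mul_Ioi (neg_lt_zero.2 hs) 0).congr_fun (fun x hx => ?_)
      measurableSet_Ioi
    simp only [abs_of_pos (Set.mem_Ioi.1 hx)]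

lemma integral_exp_neg_mul_abs_mul_cexp {s : ℝ} (hs : 0 < s) (y : ℝ) :
    ∫ x : ℝ, (Real.exp (-s * |x|) : ℂ) * Complex.exp (Complex.I * y * x) =
      2 * s / (s ^ 2 + y ^ 2) := by
  have hI : Integrable fun x : ℝ =>
      (Real.exp (-s * |x|) : ℂ) * Complex.exp (Complex.I * y * x) := by
    refine (integrable_exp_neg_mul_abs hs).mono' (by fun_prop) (.of_forall fun x => ?_)
    rw [norm_mul, Complex.norm_real, Real.norm_of_nonneg (Real.exp_pos _).le,
      show Complex.I * y * x = ((y * x : ℝ) : ℂ) * Complex.I by push_cast; ring,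
      Complex.norm_exp_ofReal_mul_I, mul_one]
  rw [← integral_add_compl measurableSet_Iic hI (s := Set.Iic (0 : ℝ)), Set.compl_Iic]
  have e1 : ∫ x in Set.Iic (0 : ℝ), (Real.exp (-s * |x|) : ℂ) * Complex.exp (Complex.I * y * x) =
      ∫ x in Set.Iic (0 : ℝ), Complex.exp ((s + Complex.I * y) * x) := by
    refine setIntegral_congr_fun measurableSet_Iic fun x hx => ?_
    simp only [abs_of_nonpos (Set.mem_Iic.1 hx), Complex.ofReal_exp]
    rw [← Complex.exp_add]; push_cast; ring_nf
  have e2 : ∫ x in Set.Ioi (0 : ℝ), (Real.exp (-s * |x|) : ℂ) * Complex.exp (Complex.I * y * x) =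
      ∫ x in Set.Ioi (0 : ℝ), Complex.exp ((-s + Complex.I * y) * x) := by
    refine setIntegral_congr_fun measurableSet_Ioi fun x hx => ?_
    simp only [abs_of_pos (Set.mem_Ioi.1 hx), Complex.ofReal_exp]
    rw [← Complex.exp_add]; push_cast; ring_nf
  have n1 : (s : ℂ) + Complex.I * y ≠ 0 := fun h => by
    have := congrArg Complex.re h; simp at this; linarith
  have n2 : -(s : ℂ) + Complex.I * y ≠ 0 := fun h => by
    have := congrArg Complex.re h; simp at this; linarith
  have n3 : (s : ℂ) ^ 2 + y ^ 2 ≠ 0 := by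
    have : s ^ 2 + y ^ 2 ≠ 0 := by positivity
    exact_mod_cast this
  rw [e1, e2, integral_exp_mul_complex_Iic (by simpa using hs),
    integral_exp_mul_complex_Ioi (by simpa using hs)]
  simp only [Complex.ofReal_zero, mul_zero, Complex.exp_zero]
  field_simp
  linear_combination (-2 * s * y ^ 2 : ℂ) * Complex.I_sq

/-- Fourier inversion for `exp (-s |x|)`, with the frequency rescaled by `2π`. -/
lemma integral_inv_sq_add_sq_mul_cexp {s : ℝ} (hs : 0 < s) (x : ℝ) :
    ∫ y : ℝ, ((s ^ 2 + y ^ 2)⁻¹ : ℝ) * Complex.exp (Complex.I * x * y) =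
      Real.pi / s * Real.exp (-s * |x|) := by
  have hpi := Real.pi_pos
  set f : ℝ → ℂ := fun x => (Real.exp (-s * |x|) : ℂ) with hf
  have hF : FourierTransform.fourier f =
      fun ξ : ℝ => ((2 * s * (s ^ 2 + (2 * Real.pi * ξ) ^ 2)⁻¹ : ℝ) : ℂ) := by
    ext ξ
    rw [Real.fourier_eq']
    have := integral_exp_neg_mul_abs_mul_cexp hs (-(2 * Real.pi * ξ))
    push_cast at this ⊢
    rw [← div_eq_mul_inv, ← neg_sq (2 * (Real.pi : ℂ) * ξ), ← this]
    refine integral_congr_ae (.of_forall fun v => ?_)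
    simp only [hf, smul_eq_mul]
    rw [mul_comm]
    simp
    ring_nf
  have hi := (integrable_exp_neg_mul_abs hs).ofReal (𝕜 := ℂ)
  have hc : Continuous f := by fun_prop
  have hg := (integrable_inv_add_sq (p := s ^ 2) (by positivity)).const_mul (2 * s)
  have h2 : (2 * Real.pi) ≠ 0 := by positivity
  have hFi : Integrable (FourierTransform.fourier f) := by
    rw [hF]
    exact (hg.comp_mul_left' h2).ofReal
  have inv := congrFun (hc.fourierInv_fourier_eq hi hFi) x
  rw [hF, Real.fourierInv_eq'] at inv
  have sub := Measure.integral_comp_mul_left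
    (fun y : ℝ => (((s ^ 2 + y ^ 2)⁻¹ : ℝ) : ℂ) * Complex.exp (Complex.I * x * y)) (2 * Real.pi)
  have e : ∀ v : ℝ, Complex.exp ((2 * Real.pi * inner ℝ v x : ℝ) * Complex.I) •
      ((2 * s * (s ^ 2 + (2 * Real.pi * v) ^ 2)⁻¹ : ℝ) : ℂ) = (2 * s : ℂ) *
      ((((s ^ 2 + (2 * Real.pi * v) ^ 2)⁻¹ : ℝ) : ℂ) *
        Complex.exp (Complex.I * x * (2 * Real.pi * v : ℝ))) := fun v => by
    simp only [smul_eq_mul]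
    rw [show ((2 * Real.pi * inner ℝ v x : ℝ) : ℂ) * Complex.I =
      Complex.I * x * (2 * Real.pi * v : ℝ) by simp; ring]
    push_cast; ring
  simp_rw [e] at inv
  rw [integral_const_mul, sub] at inv
  simp only [hf] at inv
  rw [← inv, abs_of_pos (by positivity), Complex.real_smul]
  have : (s : ℂ) ≠ 0 := by exact_mod_cast hs.ne'
  have : (Real.pi : ℂ) ≠ 0 := by exact_mod_cast hpi.ne'
  generalize ∫ y : ℝ, (((s ^ 2 + y ^ 2)⁻¹ : ℝ) : ℂ) * Complex.exp (Complex.I * x * y) = z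
  push_cast
  field_simp

/-! ### The kernel as a mixture of Laplace densities -/

/-- Integration by parts gains `1 / |x|`; since `(t + y²)⁻¹` decreases, boundary terms and total
variation add up to twice its value at `N`. Keeping the factor `(t + N²)⁻¹` lets the bound integrate
over `t` to the symbol at `N`. -/
lemma norm_integral_inv_mul_cexp_le {t x N M : ℝ} (ht : 0 < t) (hx : x ≠ 0) (hN : 0 ≤ N)
    (hNM : N ≤ M) :
    ‖∫ y in N..M, ((t + y ^ 2)⁻¹ : ℝ) * Complex.exp (Complex.I * x * y)‖ ≤
      2 / |x| * (t + N ^ 2)⁻¹ := by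
  have hIx : Complex.I * (x : ℂ) ≠ 0 := mul_ne_zero Complex.I_ne_zero (by exact_mod_cast hx)
  have hx' : 0 < |x| := abs_pos.2 hx
  have hpos : ∀ y : ℝ, 0 < t + y ^ 2 := fun y => by positivity
  have d0 : ∀ y : ℝ, HasDerivAt (fun y : ℝ => (t + y ^ 2)⁻¹) (-(2 * y) / (t + y ^ 2) ^ 2) y :=
    fun y => by
      have := ((hasDerivAt_pow 2 y).const_add t).fun_inv (hpos y).ne'
      simpa using this
  have c0 : Continuous fun y : ℝ => -(2 * y) / (t + y ^ 2) ^ 2 :=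
    Continuous.div (by fun_prop) (by fun_prop) fun y => (pow_pos (hpos y) 2).ne'
  have d1 : ∀ y : ℝ, HasDerivAt (fun y : ℝ => (((t + y ^ 2)⁻¹ : ℝ) : ℂ))
      ((-(2 * y) / (t + y ^ 2) ^ 2 : ℝ) : ℂ) y := fun y => (d0 y).ofReal_comp
  have d2 : ∀ y : ℝ, HasDerivAt
      (fun y : ℝ => Complex.exp (Complex.I * x * y) / (Complex.I * x))
      (Complex.exp (Complex.I * x * y)) y := fun y => by
    have h1 : HasDerivAt (fun y : ℝ => Complex.I * x * (y : ℂ)) (Complex.I * x) y := by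
      simpa using (Complex.ofRealCLM.hasDerivAt (x := y)).const_mul (Complex.I * (x : ℂ))
    have := h1.cexp.div_const (Complex.I * x)
    rwa [mul_div_cancel_right₀ _ hIx] at this
  have hn : ∀ y : ℝ, ‖Complex.exp (Complex.I * x * y) / (Complex.I * x)‖ = 1 / |x| := fun y => by
    rw [norm_div, show Complex.I * x * y = ((x * y : ℝ) : ℂ) * Complex.I by push_cast; ring,
      Complex.norm_exp_ofReal_mul_I]
    simp
  have hn' : ∀ y : ℝ, ‖(((t + y ^ 2)⁻¹ : ℝ) : ℂ) *
      (Complex.exp (Complex.I * x * y) / (Complex.I * x))‖ = (t + y ^ 2)⁻¹ * (1 / |x|) := fun y => by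
    rw [norm_mul, hn, Complex.norm_real, Real.norm_of_nonneg (inv_nonneg.2 (hpos y).le)]
  have c1 : IntervalIntegrable (fun y : ℝ => ((-(2 * y) / (t + y ^ 2) ^ 2 : ℝ) : ℂ)) volume N M :=
    (Complex.continuous_ofReal.comp c0).intervalIntegrable _ _
  have c2 : IntervalIntegrable (fun y : ℝ => Complex.exp (Complex.I * x * y)) volume N M :=
    Continuous.intervalIntegrable (by fun_prop) _ _
  rw [intervalIntegral.integral_mul_deriv_eq_deriv_mul (fun y _ => d1 y) (fun y _ => d2 y) c1 c2]
  have b : ‖∫ y in N..M, ((-(2 * y) / (t + y ^ 2) ^ 2 : ℝ) : ℂ) *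
      (Complex.exp (Complex.I * x * y) / (Complex.I * x))‖ ≤
      ∫ y in N..M, -(-(2 * y) / (t + y ^ 2) ^ 2) * (1 / |x|) := by
    refine intervalIntegral.norm_integral_le_of_norm_le hNM (.of_forall fun y hy => ?_)
      (Continuous.intervalIntegrable (by fun_prop) _ _)
    rw [norm_mul, hn, Complex.norm_real, Real.norm_of_nonpos]
    have : 0 < y := hN.trans_lt hy.1
    rw [neg_div]
    exact neg_nonpos.2 (by positivity)
  rw [intervalIntegral.integral_mul_const, intervalIntegral.integral_neg,
    intervalIntegral.integral_eq_sub_of_hasDerivAt (fun y _ => d0 y) (c0.intervalIntegrable _ _)]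
    at b
  refine (norm_sub_le _ _).trans ((add_le_add ((norm_sub_le _ _).trans
    (add_le_add (hn' M).le (hn' N).le)) b).trans (le_of_eq ?_))
  field_simp
  ring

/-- The truncated inverse Fourier integral of `y ↦ (t + y²)⁻¹`. -/
noncomputable def truncated (t x N : ℝ) : ℂ :=
  ∫ y in (-N)..N, ((t + y ^ 2)⁻¹ : ℝ) * Complex.exp (Complex.I * x * y)

/-- The Laplace density of scale `1 / √t`, with total mass `1 / t`. -/
noncomputable def laplace (t x : ℝ) : ℝ := Real.exp (-Real.sqrt t * |x|) / (2 * Real.sqrt t)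

lemma norm_truncated_sub_le {t x N : ℝ} (ht : 0 < t) (hx : x ≠ 0) (hN : 0 ≤ N) :
    ‖truncated t x N - 2 * Real.pi * laplace t x‖ ≤ 4 / |x| * (t + N ^ 2)⁻¹ := by
  have hs := Real.sqrt_pos.2 ht
  have hc : Continuous fun y : ℝ => (((t + y ^ 2)⁻¹ : ℝ) : ℂ) * Complex.exp (Complex.I * x * y) :=
    (Complex.continuous_ofReal.comp (Continuous.inv₀ (by fun_prop) fun y => by positivity)).mul
      (by fun_prop)
  have hi : Integrable fun y : ℝ => (((t + y ^ 2)⁻¹ : ℝ) : ℂ) * Complex.exp (Complex.I * x * y) := by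
    refine (integrable_inv_add_sq ht).mono' hc.aestronglyMeasurable (.of_forall fun y => ?_)
    rw [norm_mul, show Complex.I * x * y = ((x * y : ℝ) : ℂ) * Complex.I by push_cast; ring,
      Complex.norm_exp_ofReal_mul_I, Complex.norm_real, Real.norm_of_nonneg (by positivity),
      mul_one]
  have hlim := intervalIntegral_tendsto_integral hi tendsto_neg_atTop_atBot tendsto_id
  have e := integral_inv_sq_add_sq_mul_cexp hs x
  rw [Real.sq_sqrt ht.le] at e
  rw [e] at hlim
  have e' : (Real.pi : ℂ) / Real.sqrt t * Real.exp (-Real.sqrt t * |x|) =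
      2 * Real.pi * laplace t x := by
    unfold laplace; push_cast
    have : (Real.sqrt t : ℂ) ≠ 0 := by exact_mod_cast hs.ne'
    field_simp
  rw [e'] at hlim
  have hb := (hlim.const_sub (truncated t x N)).norm
  refine le_of_tendsto hb ?_
  -- The error is two tails, the left one being reflected into a right one with `-x`; hence the
  -- constant `4`.
  filter_upwards [eventually_ge_atTop N] with M hM
  have hii := fun a b : ℝ => hc.intervalIntegrable (μ := volume) a b
  have hsplit : truncated t x N - (∫ y in (-M)..M,
      (((t + y ^ 2)⁻¹ : ℝ) : ℂ) * Complex.exp (Complex.I * x * y)) =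
      -((∫ y in N..M, (((t + y ^ 2)⁻¹ : ℝ) : ℂ) * Complex.exp (Complex.I * x * y)) +
        ∫ y in N..M, (((t + y ^ 2)⁻¹ : ℝ) : ℂ) * Complex.exp (Complex.I * (-x : ℝ) * y)) := by
    have h1 := intervalIntegral.integral_comp_neg (a := N) (b := M)
      (fun y : ℝ => (((t + y ^ 2)⁻¹ : ℝ) : ℂ) * Complex.exp (Complex.I * x * y))
    have h2 : ∫ y in N..M, (((t + y ^ 2)⁻¹ : ℝ) : ℂ) * Complex.exp (Complex.I * (-x : ℝ) * y) =
        ∫ y in (-M)..(-N), (((t + y ^ 2)⁻¹ : ℝ) : ℂ) * Complex.exp (Complex.I * x * y) := by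
      rw [← h1]
      refine intervalIntegral.integral_congr fun y _ => ?_
      simp
    rw [h2, ← intervalIntegral.integral_add_adjacent_intervals (hii (-M) (-N)) (hii (-N) M),
      ← intervalIntegral.integral_add_adjacent_intervals (hii (-N) N) (hii N M)]
    unfold truncated
    ring
  simp only [id]
  rw [hsplit, norm_neg]
  have b1 := norm_integral_inv_mul_cexp_le ht hx hN hM
  have b2 := norm_integral_inv_mul_cexp_le ht (neg_ne_zero.2 hx) hN hM
  rw [abs_neg] at b2
  refine (norm_add_le _ _).trans ((add_le_add b1 b2).trans (le_of_eq ?_))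
  ring

lemma laplace_nonneg (t x : ℝ) : 0 ≤ laplace t x := by
  unfold laplace; positivity

lemma measurable_laplace : Measurable fun z : ℝ × ℝ => laplace z.1 z.2 := by
  unfold laplace; fun_prop

/-- The mixture of Laplace densities with mixing measure `μ`. -/
noncomputable def mixture (μ : Measure ℝ) (x : ℝ) : ℝ := ∫ t, laplace t x ∂μ

namespace SymbolMeasure

variable {μ : Measure ℝ}

lemma pos (h : SymbolMeasure μ) : ∀ᵐ t ∂μ, 0 < t := h.ge.mono fun _ ht => (poleSq_pos 0).trans_le ht

lemma integrable_inv (h : SymbolMeasure μ) : Integrable (fun t => t⁻¹) μ := by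
  simpa using h.integrable 0

lemma integral_inv (h : SymbolMeasure μ) : ∫ t, t⁻¹ ∂μ = 1 := by
  simpa [symbol] using h.integral_eq 0

lemma integrable_laplace (h : SymbolMeasure μ) {x : ℝ} (hx : x ≠ 0) :
    Integrable (fun t => laplace t x) μ := by
  have hx' := abs_pos.2 hx
  refine (h.integrable_inv.const_mul (1 / (2 * |x|))).mono'
    (measurable_laplace.comp measurable_prodMk_right).aestronglyMeasurable
    (h.pos.mono fun t ht => ?_)
  have hs := Real.sqrt_pos.2 ht
  rw [Real.norm_of_nonneg (laplace_nonneg t x), laplace, neg_mul, Real.exp_neg, div_le_iff₀ (by positivity)]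
  have : Real.sqrt t * |x| ≤ Real.exp (Real.sqrt t * |x|) := by
    linarith [Real.add_one_le_exp (Real.sqrt t * |x|)]
  calc _ ≤ (Real.sqrt t * |x|)⁻¹ := inv_anti₀ (by positivity) this
    _ = _ := by
      nth_rewrite 2 [← Real.mul_self_sqrt ht.le]
      field_simp

lemma integrable_prod_cexp (h : SymbolMeasure μ) (x N : ℝ) :
    Integrable (fun z : ℝ × ℝ => (((z.2 + z.1 ^ 2)⁻¹ : ℝ) : ℂ) * Complex.exp (Complex.I * x * z.1))
      ((volume.restrict (Set.Ioc (-N) N)).prod μ) := by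
  have := h.sfinite
  have hd := (integrable_const (1 : ℝ) (μ := volume.restrict (Set.Ioc (-N) N))).mul_prod
    h.integrable_inv
  refine hd.mono' (by fun_prop) ?_
  filter_upwards [Measure.quasiMeasurePreserving_snd.ae h.pos] with z hz
  rw [norm_mul, show Complex.I * x * z.1 = ((x * z.1 : ℝ) : ℂ) * Complex.I by push_cast; ring,
    Complex.norm_exp_ofReal_mul_I, Complex.norm_real, Real.norm_of_nonneg (by positivity),
    mul_one, one_mul]
  exact inv_anti₀ hz (by nlinarith)

lemma integral_symbol_mul_cexp (h : SymbolMeasure μ) (x : ℝ) {N : ℝ} (hN : 0 ≤ N) :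
    Integrable (fun t => truncated t x N) μ ∧
    ∫ y in (-N)..N, (symbol y : ℂ) * Complex.exp (Complex.I * x * y) =
      ∫ t, truncated t x N ∂μ := by
  have := h.sfinite
  have hi := h.integrable_prod_cexp x N
  have hle : -N ≤ N := by linarith
  have e : ∀ t, truncated t x N = ∫ y in Set.Ioc (-N) N,
      (((t + y ^ 2)⁻¹ : ℝ) : ℂ) * Complex.exp (Complex.I * x * y) := fun t =>
    intervalIntegral.integral_of_le hle
  simp_rw [e]
  refine ⟨hi.integral_prod_right, ?_⟩
  rw [← integral_integral_swap hi, intervalIntegral.integral_of_le hle]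
  refine integral_congr_ae (.of_forall fun y => ?_)
  simp only
  rw [integral_mul_const, integral_complex_ofReal, h.integral_eq]

/-- After exchanging integrals, the truncation error is at most a multiple of `symbol N / |x|`,
which vanishes as `N → ∞` although the symbol is not integrable. -/
lemma kernel_eq (h : SymbolMeasure μ) {x : ℝ} (hx : x ≠ 0) : kernel x = mixture μ x := by
  have hpi := Real.pi_pos
  have key : Tendsto (fun N : ℝ => (1 / (2 * (Real.pi : ℂ))) *
      ∫ ξ in (-N)..N, (symbol ξ : ℂ) * Complex.exp (Complex.I * (x : ℂ) * (ξ : ℂ))) atTop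
      (𝓝 (mixture μ x : ℂ)) := by
    rw [tendsto_iff_norm_sub_tendsto_zero]
    have hz : Tendsto (fun N => 1 / (2 * Real.pi) * (4 / |x| * symbol N)) atTop (𝓝 0) := by
      simpa using (tendsto_symbol_atTop.const_mul (4 / |x|)).const_mul (1 / (2 * Real.pi))
    refine tendsto_of_tendsto_of_tendsto_of_le_of_le' tendsto_const_nhds hz
      (.of_forall fun _ => norm_nonneg _) ?_
    filter_upwards [eventually_ge_atTop 0] with N hN
    obtain ⟨i1, e1⟩ := h.integral_symbol_mul_cexp x hN
    have i2 : Integrable (fun t => 2 * (Real.pi : ℂ) * laplace t x) μ :=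
      ((h.integrable_laplace hx).ofReal (𝕜 := ℂ)).const_mul _
    have e2 : (mixture μ x : ℂ) = 1 / (2 * (Real.pi : ℂ)) *
        ∫ t, 2 * (Real.pi : ℂ) * laplace t x ∂μ := by
      have : (Real.pi : ℂ) ≠ 0 := by exact_mod_cast hpi.ne'
      rw [integral_const_mul, integral_complex_ofReal, mixture]
      field_simp
    rw [e1, e2, ← mul_sub, ← integral_sub i1 i2, norm_mul]
    refine mul_le_mul (le_of_eq ?_) ?_ (norm_nonneg _) (by positivity)
    · simp [abs_of_pos hpi]
    · refine (norm_integral_le_of_norm_le ((h.integrable N).const_mul (4 / |x|))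
        (h.pos.mono fun t ht => norm_truncated_sub_le ht hx hN)).trans (le_of_eq ?_)
      rw [integral_const_mul, h.integral_eq]
  rw [kernel, key.limUnder_eq, Complex.ofReal_re]

end SymbolMeasure

/-! ### Sign, mass and first moment of the kernel -/

lemma integral_exp_neg_mul_abs {s : ℝ} (hs : 0 < s) :
    ∫ x : ℝ, Real.exp (-s * |x|) = 2 / s := by
  have h := integral_exp_neg_mul_abs_mul_cexp hs 0
  simp only [Complex.ofReal_zero, mul_zero, zero_mul, Complex.exp_zero, mul_one] at h
  rw [integral_complex_ofReal] at h
  have : ((∫ x : ℝ, Real.exp (-s * |x|) : ℝ) : ℂ) = ((2 * s / (s ^ 2 + 0 ^ 2) : ℝ) : ℂ) := by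
    rw [h]; push_cast; rfl
  rw [Complex.ofReal_injective this]
  field_simp
  ring

lemma integrable_laplace_right {t : ℝ} (ht : 0 < t) : Integrable (laplace t) :=
  (integrable_exp_neg_mul_abs (Real.sqrt_pos.2 ht)).div_const _

lemma integral_laplace {t : ℝ} (ht : 0 < t) : ∫ x, laplace t x = t⁻¹ := by
  have := Real.sqrt_pos.2 ht
  unfold laplace
  rw [integral_div, integral_exp_neg_mul_abs this]
  nth_rewrite 3 [← Real.mul_self_sqrt ht.le]
  field_simp

/-- Half of the exponential absorbs `|x|`; the other half decays uniformly in `t ≥ a`, which gives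
`K` a first moment because `μ` lives on `t ≥ poleSq 0`. -/
lemma abs_mul_laplace_le {a t : ℝ} (ha : 0 < a) (hat : a ≤ t) (x : ℝ) :
    |x| * laplace t x ≤ Real.exp (-(Real.sqrt a / 2) * |x|) * t⁻¹ := by
  have ht := ha.trans_le hat
  have hs := Real.sqrt_pos.2 ht
  have h1 : Real.sqrt t / 2 * |x| ≤ Real.exp (Real.sqrt t / 2 * |x|) := by
    linarith [Real.add_one_le_exp (Real.sqrt t / 2 * |x|)]
  have h2 : Real.exp (-Real.sqrt t * |x|) * Real.exp (Real.sqrt t / 2 * |x|) =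
      Real.exp (-(Real.sqrt t / 2) * |x|) := by
    rw [← Real.exp_add]; ring_nf
  have h3 : Real.exp (-(Real.sqrt t / 2) * |x|) ≤ Real.exp (-(Real.sqrt a / 2) * |x|) := by
    gcongr
  have e : |x| * laplace t x =
      Real.exp (-Real.sqrt t * |x|) * (Real.sqrt t / 2 * |x|) * t⁻¹ := by
    unfold laplace
    nth_rewrite 5 [← Real.mul_self_sqrt ht.le]
    field_simp
  rw [e]
  have := mul_le_mul_of_nonneg_left h1 (Real.exp_pos (-Real.sqrt t * |x|)).le
  exact mul_le_mul_of_nonneg_right (by linarith) (by positivity)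

lemma mixture_neg (μ : Measure ℝ) (x : ℝ) : mixture μ (-x) = mixture μ x := by
  simp [mixture, laplace]

namespace SymbolMeasure

variable {μ : Measure ℝ}

lemma integrable_laplace_prod (h : SymbolMeasure μ) :
    Integrable (fun z : ℝ × ℝ => laplace z.2 z.1) (volume.prod μ) := by
  have := h.sfinite
  have hm : AEStronglyMeasurable (fun z : ℝ × ℝ => laplace z.2 z.1) (volume.prod μ) :=
    (measurable_laplace.comp measurable_swap).aestronglyMeasurable
  rw [integrable_prod_iff' hm]
  refine ⟨h.pos.mono fun t ht => integrable_laplace_right ht,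
    h.integrable_inv.congr (h.pos.mono fun t ht => ?_)⟩
  simp_rw [Real.norm_of_nonneg (laplace_nonneg _ _)]
  exact (integral_laplace ht).symm

lemma integrable_mul_laplace_prod (h : SymbolMeasure μ) :
    Integrable (fun z : ℝ × ℝ => z.1 * laplace z.2 z.1) (volume.prod μ) := by
  have := h.sfinite
  have hm : AEStronglyMeasurable (fun z : ℝ × ℝ => z.1 * laplace z.2 z.1) (volume.prod μ) :=
    (measurable_fst.mul (measurable_laplace.comp measurable_swap)).aestronglyMeasurable
  have hs : 0 < Real.sqrt (poleSq 0) / 2 := half_pos (Real.sqrt_pos.2 (poleSq_pos 0))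
  refine ((integrable_exp_neg_mul_abs hs).mul_prod h.integrable_inv).mono' hm ?_
  filter_upwards [Measure.quasiMeasurePreserving_snd.ae h.ge] with z hz
  rw [norm_mul, Real.norm_of_nonneg (laplace_nonneg _ _)]
  exact abs_mul_laplace_le (poleSq_pos 0) hz z.1

lemma kernel_ae_eq (h : SymbolMeasure μ) : kernel =ᵐ[volume] mixture μ := by
  filter_upwards [compl_mem_ae_iff.2 (measure_singleton (0 : ℝ))] with x hx
  exact h.kernel_eq hx

end SymbolMeasure

lemma integrable_kernel : Integrable kernel := by
  obtain ⟨μ, h⟩ := exists_symbolMeasure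
  have := h.sfinite
  exact h.integrable_laplace_prod.integral_prod_left.congr h.kernel_ae_eq.symm

lemma integral_kernel : ∫ x, kernel x = 1 := by
  obtain ⟨μ, h⟩ := exists_symbolMeasure
  have := h.sfinite
  rw [integral_congr_ae h.kernel_ae_eq]
  unfold mixture
  rw [integral_integral_swap h.integrable_laplace_prod, ← h.integral_inv]
  exact integral_congr_ae (h.pos.mono fun t ht => integral_laplace ht)

lemma kernel_nonneg_ae : ∀ᵐ x, 0 ≤ kernel x := by
  obtain ⟨μ, h⟩ := exists_symbolMeasure
  filter_upwards [h.kernel_ae_eq] with x hx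
  rw [hx]
  exact integral_nonneg fun t => laplace_nonneg t x

lemma integrable_mul_kernel : Integrable fun x => x * kernel x := by
  obtain ⟨μ, h⟩ := exists_symbolMeasure
  have := h.sfinite
  refine h.integrable_mul_laplace_prod.integral_prod_left.congr ?_
  filter_upwards [h.kernel_ae_eq] with x hx
  rw [hx, integral_const_mul, mixture]

lemma integral_mul_kernel : ∫ x, x * kernel x = 0 := by
  obtain ⟨μ, h⟩ := exists_symbolMeasure
  have e : ∫ x, x * kernel x = ∫ x, x * mixture μ x :=
    integral_congr_ae (h.kernel_ae_eq.mono fun x hx => by simp only [hx])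
  have e2 := integral_neg_eq_self (fun x => x * mixture μ x) volume
  simp only [mixture_neg, neg_mul, integral_neg] at e2
  linarith

/-! ### Bounded solutions with limits at infinity -/

section Solutions

variable {φ : ℝ → ℝ} {C a b c : ℝ}

/-- Stated for a translation-invariant filter so that it serves both ends of the line. -/
lemma tendsto_integral_window {f : Filter ℝ} (hφ : Continuous φ)
    (hlim : Tendsto φ f (𝓝 b)) (y : ℝ) (hadd : ∀ v : ℝ, Tendsto (fun R => R + v) f f)
    [f.IsCountablyGenerated] (hC : ∀ x, |φ x| ≤ C) :
    Tendsto (fun R => ∫ x in (R - y)..R, φ x) f (𝓝 (y * b)) := by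
  have e : ∀ R, ∫ x in (R - y)..R, φ x = ∫ v in (-y)..0, φ (R + v) := fun R => by
    rw [intervalIntegral.integral_comp_add_left]; simp [sub_eq_add_neg]
  simp_rw [e]
  have : y * b = ∫ _ in (-y)..0, b := by simp
  rw [this]
  refine intervalIntegral.tendsto_integral_filter_of_dominated_convergence (fun _ => C)
    (.of_forall fun R => by fun_prop) (.of_forall fun R => .of_forall fun v _ => hC _) (by simp)
    (.of_forall fun v _ => hlim.comp (hadd v))

lemma norm_integral_window_le (hC : ∀ x, |φ x| ≤ C) (R y : ℝ) :
    ‖∫ x in (R - y)..R, φ x‖ ≤ C * |y| := by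
  simpa using intervalIntegral.norm_integral_le_of_norm_le_const (a := R - y) (b := R) (f := φ)
    (C := C) fun x _ => hC x

lemma integrable_kernel_mul (hφ : Continuous φ) (hC : ∀ x, |φ x| ≤ C) (x : ℝ) :
    Integrable fun y => kernel y * φ (x - y) :=
  integrable_kernel.mul_bdd (c := C) (by fun_prop) (.of_forall fun _ => hC _)

lemma IsSolution.mul_sub_eq (hsol : IsSolution c φ) (hφ : Continuous φ) (hC : ∀ x, |φ x| ≤ C)
    (x : ℝ) : φ x * (φ x - (c - 1)) = ∫ y, kernel y * (φ x - φ (x - y)) := by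
  have h := hsol x
  simp only [convolution, ContinuousLinearMap.mul_apply'] at h
  simp_rw [mul_sub]
  rw [integral_sub (integrable_kernel.mul_const _) (integrable_kernel_mul hφ hC x),
    integral_mul_const, integral_kernel]
  linarith

/-- For fixed `y`, the integral of `φ(x) - φ(x - y)` over `[-R, R]` collapses to two windows of
signed length `y`, bounded together by `2 C |y|`. The first moment of `K` thus supplies the
dominating function. -/
lemma IsSolution.tendsto_integral (hsol : IsSolution c φ) (hφ : Continuous φ)
    (hC : ∀ x, |φ x| ≤ C) (ha : Tendsto φ atBot (𝓝 a)) (hb : Tendsto φ atTop (𝓝 b)) :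
    Tendsto (fun R : ℝ => ∫ x in (-R)..R, φ x * (φ x - (c - 1))) atTop (𝓝 0) := by
  have hii := fun u v : ℝ => hφ.intervalIntegrable (μ := volume) u v
  have e : ∀ R : ℝ, ∫ x in (-R)..R, φ x * (φ x - (c - 1)) =
      ∫ y, kernel y * ((∫ x in (R - y)..R, φ x) - ∫ x in (-R - y)..(-R), φ x) := fun R => by
    simp_rw [hsol.mul_sub_eq hφ hC]
    rw [intervalIntegral_integral_swap]
    · refine integral_congr_ae (.of_forall fun y => ?_)
      simp only
      rw [intervalIntegral.integral_const_mul, intervalIntegral.integral_sub (hii _ _)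
        (Continuous.intervalIntegrable (by fun_prop) _ _),
        intervalIntegral.integral_comp_sub_right,
        ← intervalIntegral.integral_add_adjacent_intervals (hii (-R - y) (-R)) (hii (-R) (R - y)),
        ← intervalIntegral.integral_add_adjacent_intervals (hii (-R) (R - y)) (hii (R - y) R)]
      ring
    · have : IsFiniteMeasure (volume.restrict (Set.uIoc (-R) R)) := ⟨by simp [Set.uIoc]⟩
      have hd := (integrable_const (2 * C) (μ := volume.restrict (Set.uIoc (-R) R))).mul_prod
        integrable_kernel.norm
      refine hd.mono' ?_ (.of_forall fun z => ?_)
      · exact integrable_kernel.aestronglyMeasurable.comp_snd.mul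
          (Continuous.aestronglyMeasurable (by fun_prop))
      · simp only [Function.uncurry, norm_mul]
        rw [mul_comm]
        refine mul_le_mul_of_nonneg_right ((norm_sub_le _ _).trans ?_) (norm_nonneg _)
        have h1 := hC z.1
        have h2 := hC (z.1 - z.2)
        simp only [Real.norm_eq_abs]
        linarith
  simp_rw [e]
  have hz : (0 : ℝ) = ∫ y, kernel y * (y * b - y * a) := by
    have : ∀ y, kernel y * (y * b - y * a) = (y * kernel y) * (b - a) := fun y => by ring
    simp_rw [this]
    rw [integral_mul_const, integral_mul_kernel, zero_mul]
  rw [hz]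
  refine tendsto_integral_filter_of_dominated_convergence (fun y => 2 * C * ‖y * kernel y‖)
    (.of_forall fun R => ?_) (.of_forall fun R => .of_forall fun y => ?_)
    (integrable_mul_kernel.norm.const_mul _) (.of_forall fun y => ?_)
  · refine integrable_kernel.aestronglyMeasurable.mul (Continuous.aestronglyMeasurable ?_)
    -- A primitive of `φ` shows that the windows are continuous in `y`, hence measurable.
    have e2 : ∀ R y : ℝ, ∫ x in (R - y)..R, φ x = (∫ x in (0 : ℝ)..R, φ x) - ∫ x in (0 : ℝ)..(R - y), φ x :=
      fun R y => by rw [intervalIntegral.integral_interval_sub_left (hii _ _) (hii _ _)]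
    simp_rw [e2]
    have hc := intervalIntegral.continuous_primitive hii 0
    exact (continuous_const.sub (hc.comp (by fun_prop))).sub
      (continuous_const.sub (hc.comp (by fun_prop)))
  · have h1 := norm_integral_window_le hC R y
    have h2 := norm_integral_window_le hC (-R) y
    rw [norm_mul, norm_mul, Real.norm_eq_abs y]
    calc _ ≤ ‖kernel y‖ * (C * |y| + C * |y|) :=
          mul_le_mul_of_nonneg_left ((norm_sub_le _ _).trans (add_le_add h1 h2)) (norm_nonneg _)
      _ = _ := by ring
  · refine Tendsto.const_mul _ (Tendsto.sub ?_ ?_)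
    · exact tendsto_integral_window hφ hb y (fun v => tendsto_atTop_add_const_right _ v tendsto_id) hC
    · exact (tendsto_integral_window hφ ha y
        (fun v => tendsto_atBot_add_const_right _ v tendsto_id) hC).comp tendsto_neg_atTop_atBot

/-- `K` is a probability density, so `K * φ ≥ inf φ`. The infimum need not be attained, so the
pointwise inequality is carried to it by closedness. -/
lemma IsSolution.le_iInf (hsol : IsSolution c φ) (hφ : Continuous φ) (hC : ∀ x, |φ x| ≤ C) :
    ⨅ x, φ x ≤ c * (⨅ x, φ x) - (⨅ x, φ x) ^ 2 := by
  have hbb : BddBelow (Set.range φ) := ⟨-C, by rintro _ ⟨x, rfl⟩; exact (abs_le.1 (hC x)).1⟩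
  have hle : ∀ x, ⨅ x, φ x ≤ c * φ x - φ x ^ 2 := fun x => by
    have h := hsol x
    simp only [convolution, ContinuousLinearMap.mul_apply'] at h
    have h1 : ∫ y, kernel y * ⨅ x, φ x ≤ ∫ y, kernel y * φ (x - y) := by
      refine integral_mono_ae (integrable_kernel.mul_const _) (integrable_kernel_mul hφ hC x) ?_
      filter_upwards [kernel_nonneg_ae] with y hy
      exact mul_le_mul_of_nonneg_left (ciInf_le hbb _) hy
    rw [integral_mul_const, integral_kernel, one_mul] at h1
    linarith
  have hcl : IsClosed {v : ℝ | ⨅ x, φ x ≤ c * v - v ^ 2} :=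
    isClosed_le continuous_const (by fun_prop)
  have hmem : ⨅ x, φ x ∈ closure (Set.range φ) := csInf_mem_closure (Set.range_nonempty φ) hbb
  have hsub : Set.range φ ⊆ {v : ℝ | ⨅ x, φ x ≤ c * v - v ^ 2} := Set.range_subset_iff.2 hle
  exact closure_minimal hsub hcl hmem

lemma eq_zero_of_tendsto_integral {g : ℝ → ℝ} (hg : Continuous g) (h0 : ∀ x, 0 ≤ g x)
    (hlim : Tendsto (fun R : ℝ => ∫ x in (-R)..R, g x) atTop (𝓝 0)) (x : ℝ) : g x = 0 := by
  by_contra hne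
  have hpos : 0 < ∫ y in (-(|x| + 1))..(|x| + 1), g y := by
    refine intervalIntegral.integral_pos (by linarith [abs_nonneg x]) hg.continuousOn
      (fun y _ => h0 y) ⟨x, ⟨?_, ?_⟩, lt_of_le_of_ne (h0 x) (Ne.symm hne)⟩
    · linarith [neg_abs_le x]
    · linarith [le_abs_self x]
  refine hpos.not_ge (ge_of_tendsto hlim ?_)
  filter_upwards [eventually_ge_atTop (|x| + 1)] with R hR
  exact intervalIntegral.integral_mono_interval (by linarith) (by linarith [abs_nonneg x]) hR
    (.of_forall h0) (hg.intervalIntegrable _ _)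

/-- A continuous function taking both values would also take `d / 2`. -/
lemma eq_zero_or_eq_of_mul_eq_zero {d : ℝ} (hφ : Continuous φ) (h : ∀ x, φ x * (φ x - d) = 0) :
    (∀ x, φ x = 0) ∨ ∀ x, φ x = d := by
  have h' : ∀ x, φ x = 0 ∨ φ x = d := fun x => (mul_eq_zero.1 (h x)).imp_right sub_eq_zero.1
  by_contra! hne
  obtain ⟨⟨x, hx⟩, ⟨y, hy⟩⟩ := hne
  have hx' := (h' x).resolve_left hx
  have hy' := (h' y).resolve_right hy
  have hd : d ≠ 0 := hx' ▸ hx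
  have hmid : d / 2 ∈ Set.range φ := by
    rcases lt_or_gt_of_ne hd with hd | hd
    · exact mem_range_of_exists_le_of_exists_ge hφ ⟨x, by linarith⟩ ⟨y, by linarith⟩
    · exact mem_range_of_exists_le_of_exists_ge hφ ⟨y, by linarith⟩ ⟨x, by linarith⟩
  obtain ⟨z, hz⟩ := hmid
  rcases h' z with h | h <;> apply hd <;> linarith

end Solutions

end Whitham

theorem proposition2p2 (c : ℝ) (φ : ℝ → ℝ)
    (hsol : Whitham.IsSolution c φ)
    (hbdd : ∃ C : ℝ, ∀ x : ℝ, |φ x| ≤ C)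
    (hbot : ∃ a : ℝ, Tendsto φ atBot (𝓝 a))
    (htop : ∃ b : ℝ, Tendsto φ atTop (𝓝 b)) :
    (ContDiff ℝ 1 φ →
      Tendsto (fun R : ℝ => ∫ x in (-R)..R, φ x * (φ x - (c - 1))) atTop (𝓝 0)) ∧
    (Continuous φ → 1 ≤ c →
      ((⨅ x : ℝ, φ x) < c - 1 ∧ c - 1 < ⨆ x : ℝ, φ x) ∨
        (∀ x : ℝ, φ x = 0) ∨ (∀ x : ℝ, φ x = c - 1)) := by
  obtain ⟨C, hC⟩ := hbdd
  obtain ⟨a, ha⟩ := hbot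
  obtain ⟨b, hb⟩ := htop
  refine ⟨fun hφ => hsol.tendsto_integral hφ.continuous hC ha hb, fun hφ hc => ?_⟩
  have hlim := hsol.tendsto_integral hφ hC ha hb
  have hbb : BddBelow (Set.range φ) := ⟨-C, by rintro _ ⟨x, rfl⟩; exact (abs_le.1 (hC x)).1⟩
  have hba : BddAbove (Set.range φ) := ⟨C, by rintro _ ⟨x, rfl⟩; exact (abs_le.1 (hC x)).2⟩
  have hinf := hsol.le_iInf hφ hC
  -- `hinf` says `m (m - (c - 1)) ≤ 0` for the infimum `m`; if `m < 0 ≤ c - 1`, both factors are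
  -- negative.
  have hnn : 0 ≤ ⨅ x, φ x := by
    by_contra! hneg
    nlinarith
  have hφ0 : ∀ x, 0 ≤ φ x := fun x => hnn.trans (ciInf_le hbb x)
  refine or_iff_not_imp_left.2 fun hnot => Whitham.eq_zero_or_eq_of_mul_eq_zero hφ ?_
  -- Either `0 ≤ φ ≤ c - 1` or `φ ≥ c - 1`; the integrand is nonpositive in the first case and
  -- nonnegative in the second.
  by_cases h : (⨅ x, φ x) < c - 1
  · have hsup : ⨆ x, φ x ≤ c - 1 := not_lt.1 fun h' => hnot ⟨h, h'⟩
    intro x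
    refine neg_eq_zero.1 (Whitham.eq_zero_of_tendsto_integral (g := fun x => -(φ x * (φ x - (c - 1))))
      (by fun_prop) (fun x => ?_) ?_ x)
    · have := (le_ciSup hba x).trans hsup
      nlinarith [hφ0 x]
    · simp_rw [intervalIntegral.integral_neg]
      simpa using hlim.neg
  · refine Whitham.eq_zero_of_tendsto_integral (by fun_prop) (fun x => ?_) hlim
    have := (not_lt.1 h).trans (ciInf_le hbb x)
    exact mul_nonneg (hφ0 x) (by linarith)
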